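/- For a Boolean algebra $B$, let $B^+=\{x\in B: x\neq 0\}$ and let the algebraic density $\pi(B)$ be the least cardinality of a set $X\subseteq B^+$ such that for every $y\in B^+$ there is $x\in X$ with $x\le y$. For cardinals $\mu,\kappa$ let $\mu^{<\kappa}=\sup_{\nu<\kappa}\mu^{\nu}$ (with $\nu$ ranging over cardinals). **Theorem.** Let $B$ be a Boolean algebra and let $\lambda$ be an infinite cardinal. Suppose that at least one of the following holds: - (A) $\pi(B)>\lambda$ and $\operatorname{cf}(\lambda)=\aleph_0$; - (B) $\pi(B)>\lambda$ and $\mu^{<\operatorname{cf}(\lambda)}<\lambda$ for every cardinal $\mu<\lambda$; - (C) $\pi(B)>\lambda$ and $2^{\mu}<\pi(B)$ for every cardinal $\mu<\lambda$; - (C') $\pi(B)\ge\lambda$ and $2^{\mu}<|B|$ for every cardinal $\mu<\lambda$. Then $B$ has a subalgebra $B'$ such that $\pi(B')=|B'|=\lambda$. -/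

import Mathlib

open Cardinal

universe u

/-- `X` is a dense subset of `B⁺`: it consists of nonzero elements, and every nonzero element of
`B` has a member of `X` below it. -/
def IsAlgDense {B : Type u} [BooleanAlgebra B] (X : Set B) : Prop :=
  (∀ x ∈ X, x ≠ ⊥) ∧ ∀ y : B, y ≠ ⊥ → ∃ x ∈ X, x ≤ y

/-- The algebraic density `π(B)`: the least cardinality of a dense subset of `B⁺`. -/
noncomputable def algDensity (B : Type u) [BooleanAlgebra B] : Cardinal.{u} :=
  sInf {c : Cardinal | ∃ X : Set B, IsAlgDense X ∧ #X = c}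

/-- The minimum defining `π(B)` is attained. -/
theorem exists_isAlgDense_card_eq (B : Type u) [BooleanAlgebra B] :
    ∃ X : Set B, IsAlgDense X ∧ #X = algDensity B :=
  csInf_mem (s := {c : Cardinal | ∃ X : Set B, IsAlgDense X ∧ #X = c})
    ⟨_, {x : B | x ≠ ⊥}, ⟨fun _ hx => hx, fun y hy => ⟨y, hy, le_rfl⟩⟩, rfl⟩

/-! If θ is regular and a subalgebra contains a sparse set of size θ, fewer than θ nonzero elements
cannot be dense in it: together they have fewer than θ members of the sparse set above them. So a
subalgebra of size at most λ has size and density λ once it contains sparse sets of regular sizes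
exceeding each μ < λ (`algDensity_eq_of_isSparse`).

An infinite antichain is sparse in all of B. Another source is a chain of stages A_i of length θ,
with a_i chosen to have no nonzero element of A_i below it. The a_i are always sparse in the union
of the stages, which settles regular λ. If antichains are small, suitably closed stages make them
sparse in all of B (`exists_isSparse_of_antichain_card_lt`), so sparse sets of different sizes can
be thrown together.

Let λ be singular. Under (C) or (C'), each infinite μ < λ yields either an antichain of size μ⁺ or
such a chain. Condition (A) is then an instance of (B). Under (B), if no antichain exceeds λ, there
is b below which every nonzero element has density above λ. Either cf(λ) disjoint elements below b
carry separate chains, or antichains below b are smaller than cf(λ) and one chain for each required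
size is sparse in B. -/

section

variable {B : Type u} [BooleanAlgebra B]

/-- Every set of fewer than `T` elements fails to be dense below `b`. -/
def DensityGE (b : B) (T : Cardinal.{u}) : Prop :=
  ∀ X : Set B, #X < T → ∃ a ≤ b, a ≠ ⊥ ∧ ∀ x ∈ X, x ≤ a → x = ⊥

/-- `S` is a set of `θ` nonzero elements of `C`, fewer than `θ` of which lie above any given
nonzero element of `C`. -/
structure IsSparse (C S : Set B) (θ : Cardinal.{u}) : Prop where
  subset : S ⊆ C
  ne_bot : ∀ s ∈ S, s ≠ ⊥
  card_eq : #S = θ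
  card_lt : ∀ x ∈ C, x ≠ ⊥ → #{s ∈ S | x ≤ s} < θ

/-! ### Density and sparse sets -/

theorem algDensity_le_of_isAlgDense {X : Set B} (hX : IsAlgDense X) : algDensity B ≤ #X :=
  csInf_le' ⟨X, hX, rfl⟩

theorem algDensity_le_card : algDensity B ≤ #B :=
  (algDensity_le_of_isAlgDense (X := {x : B | x ≠ ⊥})
    ⟨fun _ hx => hx, fun y hy => ⟨y, hy, le_rfl⟩⟩).trans (mk_set_le _)

theorem densityGE_top {T : Cardinal.{u}} (hT : T ≤ algDensity B) : DensityGE (⊤ : B) T := by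
  intro X hX
  by_contra! h
  refine (hX.trans_le hT).not_ge ((algDensity_le_of_isAlgDense (X := {x ∈ X | x ≠ ⊥})
    ⟨fun x hx => hx.2, fun y hy => ?_⟩).trans (mk_le_mk_of_subset fun x hx => hx.1))
  obtain ⟨x, hx, hxy, hx0⟩ := h y le_top hy
  exact ⟨x, ⟨hx, hx0⟩, hxy⟩

theorem DensityGE.mono {b : B} {T T' : Cardinal.{u}} (h : DensityGE b T) (hT : T' ≤ T) :
    DensityGE b T' := fun X hX => h X (hX.trans_le hT)

theorem IsSparse.mono {C C' S : Set B} {θ : Cardinal.{u}} (h : IsSparse C S θ) (hS : S ⊆ C')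
    (hC : C' ⊆ C) : IsSparse C' S θ :=
  ⟨hS, h.ne_bot, h.card_eq, fun x hx => h.card_lt x (hC hx)⟩

theorem le_algDensity_of_isSparse {D : BooleanSubalgebra B} {S : Set B} {θ : Cardinal.{u}}
    (hθ : θ.IsRegular) (hS : IsSparse (D : Set B) S θ) : θ ≤ algDensity D := by
  obtain ⟨X, ⟨hX0, hX⟩, hXc⟩ := exists_isAlgDense_card_eq D
  rw [← hXc]
  by_contra! hlt
  have hsub : S ⊆ ⋃ x ∈ X, {s ∈ S | (x : B) ≤ s} := by
    intro s hs
    obtain ⟨x, hx, hxs⟩ := hX ⟨s, hS.subset hs⟩ fun h => hS.ne_bot s hs (congrArg Subtype.val h)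
    exact Set.mem_biUnion hx ⟨hs, hxs⟩
  have := (mk_le_mk_of_subset hsub).trans_lt
    ((card_biUnion_lt_iff_forall_of_isRegular hθ hlt).2 fun x hx =>
      hS.card_lt x x.2 fun h => hX0 x hx (Subtype.ext h))
  exact this.ne hS.card_eq

theorem algDensity_eq_of_isSparse {D : BooleanSubalgebra B} {lam : Cardinal.{u}} (hD : #D ≤ lam)
    (h : ∀ μ < lam, ∃ θ, μ < θ ∧ θ.IsRegular ∧ ∃ S, IsSparse (D : Set B) S θ) :
    algDensity D = lam ∧ #D = lam := by
  have h1 : lam ≤ algDensity D := by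
    refine le_of_forall_lt fun μ hμ => ?_
    obtain ⟨θ, hμθ, hθ, S, hS⟩ := h μ hμ
    exact hμθ.trans_le (le_algDensity_of_isSparse hθ hS)
  exact ⟨le_antisymm (algDensity_le_card.trans hD) h1,
    le_antisymm hD (h1.trans algDensity_le_card)⟩

/-! ### Sparse sets from transfinite chains -/

theorem card_Iio_toType_lt {c : Cardinal.{u}} (i : c.ord.ToType) : #(Set.Iio i) < c := by
  simpa using mk_Iio_lt i (by simp)

/-- Stage j collects A i, F (A i) and a i for all i < j. There are fewer than θ ≤ T such i, so
regularity of T keeps the stage below T and the density assumption supplies the next a j. -/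
theorem exists_chain {b : B} {T θ : Cardinal.{u}} (hT : T.IsRegular) (hle : θ ≤ T)
    (hb : DensityGE b T) {F : Set B → Set B} (hF : ∀ X : Set B, #X < T → #(F X) < T) :
    ∃ (A : θ.ord.ToType → Set B) (a : θ.ord.ToType → B),
      (∀ i, #(A i) < T) ∧ (∀ i j, i < j → A i ⊆ A j ∧ F (A i) ⊆ A j ∧ a i ∈ A j) ∧
      ∀ i, a i ≤ b ∧ a i ≠ ⊥ ∧ ∀ x ∈ A i, x ≤ a i → x = ⊥ := by
  classical
  choose! p hpb hp0 hp using hb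
  let A : θ.ord.ToType → Set B := (wellFounded_lt (α := θ.ord.ToType)).fix fun j ih =>
    ⋃ i : Set.Iio j, (ih i i.2 ∪ F (ih i i.2) ∪ {p (ih i i.2)})
  have hA : ∀ j, A j = ⋃ i : Set.Iio j, (A i ∪ F (A i) ∪ {p (A i)}) := fun j =>
    WellFounded.fix_eq _ _ j
  have hAT : ∀ j, #(A j) < T := by
    intro j
    induction j using (wellFounded_lt (α := θ.ord.ToType)).induction with
    | _ j ih =>
      rw [hA, card_iUnion_lt_iff_forall_of_isRegular hT ((card_Iio_toType_lt j).trans_le hle)]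
      intro i
      refine (mk_union_le _ _).trans_lt (add_lt_of_lt hT.aleph0_le
        ((mk_union_le _ _).trans_lt (add_lt_of_lt hT.aleph0_le (ih i i.2) (hF _ (ih i i.2)))) ?_)
      rw [mk_singleton]
      exact one_lt_aleph0.trans_le hT.aleph0_le
  have hsub : ∀ i j, i < j → A i ∪ F (A i) ∪ {p (A i)} ⊆ A j := fun i j hij => by
    rw [hA j]
    exact Set.subset_iUnion (fun i : Set.Iio j => A i ∪ F (A i) ∪ {p (A i)}) ⟨i, hij⟩
  refine ⟨A, fun i => p (A i), hAT, fun i j hij => ⟨?_, ?_, ?_⟩, fun i =>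
    ⟨hpb _ (hAT i), hp0 _ (hAT i), hp _ (hAT i)⟩⟩
  · exact fun x hx => hsub i j hij (Or.inl (Or.inl hx))
  · exact fun x hx => hsub i j hij (Or.inl (Or.inr hx))
  · exact hsub i j hij (Or.inr rfl)

theorem isSparse_range {ι : Type u} [LinearOrder ι] {a : ι → B} {C : Set B} {θ : Cardinal.{u}}
    (hι : #ι = θ) (hlt : ∀ i : ι, #(Set.Iio i) < θ) (hC : ∀ i, a i ∈ C) (h0 : ∀ i, a i ≠ ⊥)
    (ha : ∀ i j, i < j → ¬ a i ≤ a j)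
    (hbdd : ∀ x ∈ C, x ≠ ⊥ → ∃ i, ∀ j, x ≤ a j → j < i) : IsSparse C (Set.range a) θ := by
  have hinj : Function.Injective a := by
    intro i j hij
    rcases lt_trichotomy i j with h | h | h
    · exact absurd hij.le (ha i j h)
    · exact h
    · exact absurd hij.ge (ha j i h)
  refine ⟨Set.range_subset_iff.2 hC, Set.forall_mem_range.2 h0, by rw [mk_range_eq a hinj, hι],
    fun x hx hx0 => ?_⟩
  obtain ⟨i, hi⟩ := hbdd x hx hx0
  refine (mk_le_mk_of_subset (t := a '' Set.Iio i) ?_).trans_lt (mk_image_le.trans_lt (hlt i))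
  rintro _ ⟨⟨j, rfl⟩, hj⟩
  exact ⟨j, hi j hj, rfl⟩

theorem exists_gt_of_card_lt {θ : Cardinal.{u}} (hθ : θ.IsRegular) {s : Set θ.ord.ToType}
    (hs : #s < θ) : ∃ i, ∀ j ∈ s, j < i := by
  rw [← not_isCofinal_iff]
  intro h
  refine hs.not_ge ?_
  have := Order.cof_le h
  rwa [Ordinal.cof_toType, hθ.cof_ord] at this

/-- A nonzero x in stage i lies below no a j with j ≥ i, so sparseness holds inside the union of the
stages, though perhaps not in B. Closure under joins and differences lets this set serve as a piece
of a subalgebra. -/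
theorem exists_isSparse_of_densityGE {b : B} {θ : Cardinal.{u}} (hθ : θ.IsRegular)
    (hb : DensityGE b θ) :
    ∃ A : Set B, #A ≤ θ ∧ b ∈ A ∧ (∀ x ∈ A, x ≤ b) ∧
      (∀ x ∈ A, ∀ y ∈ A, x ⊔ y ∈ A) ∧ (∀ x ∈ A, ∀ y ∈ A, x \ y ∈ A) ∧ ∃ S, IsSparse A S θ := by
  obtain ⟨A, a, hAc, hA, ha⟩ := exists_chain hθ le_rfl hb
    (F := fun X => insert b (Set.image2 (· ⊔ ·) X X ∪ Set.image2 (· \ ·) X X)) (by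
      intro X hX
      have h2 : #X * #X < θ := mul_lt_of_lt hθ.aleph0_le hX hX
      refine (mk_insert_le).trans_lt (add_lt_of_lt hθ.aleph0_le ((mk_union_le _ _).trans_lt
        (add_lt_of_lt hθ.aleph0_le ?_ ?_)) (one_lt_aleph0.trans_le hθ.aleph0_le))
      · exact mk_image2_le.trans_lt h2
      · exact mk_image2_le.trans_lt h2)
  have hgt : ∀ i : θ.ord.ToType, ∃ j, i < j := fun i => by
    obtain ⟨j, hj⟩ := exists_gt_of_card_lt hθ (s := {i})
      (by rw [mk_singleton]; exact one_lt_aleph0.trans_le hθ.aleph0_le)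
    exact ⟨j, hj i rfl⟩
  have hmono : Monotone A := fun i j hij => by
    rcases hij.eq_or_lt with rfl | h
    · exact le_rfl
    · exact (hA i j h).1
  have hcl : ∀ x ∈ ⋃ i, A i, ∀ y ∈ ⋃ i, A i, x ⊔ y ∈ ⋃ i, A i ∧ x \ y ∈ ⋃ i, A i := by
    simp only [Set.mem_iUnion]
    rintro x ⟨i, hi⟩ y ⟨j, hj⟩
    obtain ⟨k, hk⟩ := hgt (max i j)
    have hi' := hmono (le_max_left i j) hi
    have hj' := hmono (le_max_right i j) hj
    exact ⟨⟨k, (hA _ k hk).2.1 (Or.inr (Or.inl ⟨x, hi', y, hj', rfl⟩))⟩,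
      ⟨k, (hA _ k hk).2.1 (Or.inr (Or.inr ⟨x, hi', y, hj', rfl⟩))⟩⟩
  obtain ⟨i₀, -⟩ := exists_gt_of_card_lt hθ (s := ∅) (by simpa using hθ.pos)
  obtain ⟨i₁, h01⟩ := hgt i₀
  have haA : ∀ i, a i ∈ ⋃ i, A i := fun i => by
    obtain ⟨j, hj⟩ := hgt i
    exact Set.mem_iUnion.2 ⟨j, (hA i j hj).2.2⟩
  refine ⟨{x ∈ ⋃ i, A i | x ≤ b}, ?_, ⟨Set.mem_iUnion.2 ⟨i₁, (hA _ _ h01).2.1 (Or.inl rfl)⟩,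
    le_rfl⟩, fun x hx => hx.2, fun x hx y hy => ⟨(hcl x hx.1 y hy.1).1, sup_le hx.2 hy.2⟩,
    fun x hx y hy => ⟨(hcl x hx.1 y hy.1).2, sdiff_le.trans hx.2⟩, Set.range a,
    isSparse_range (mk_ord_toType θ) card_Iio_toType_lt (fun i => ⟨haA i, (ha i).1⟩)
      (fun i => (ha i).2.1) (fun i j hij h => (ha i).2.1 ((ha j).2.2 _ (hA i j hij).2.2 h)) ?_⟩
  · refine (mk_le_mk_of_subset (Set.sep_subset _ _)).trans ((mk_iUnion_le A).trans ?_)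
    rw [mk_ord_toType]
    exact (mul_le_mul_right (ciSup_le' fun i => (hAc i).le) θ).trans
      (mul_eq_self hθ.aleph0_le).le
  · rintro x ⟨hx, -⟩ hx0
    obtain ⟨i, hi⟩ := Set.mem_iUnion.1 hx
    refine ⟨i, fun j hj => ?_⟩
    by_contra! hij
    exact hx0 ((ha j).2.2 x (hmono hij hi) hj)

theorem exists_maximal_pairwiseDisjoint (P : Set B) :
    ∃ W ⊆ P, W.PairwiseDisjoint id ∧ ∀ x ∈ P, (∀ w ∈ W, Disjoint x w) → x ∈ W := by
  obtain ⟨W, hW⟩ := zorn_subset {W : Set B | W ⊆ P ∧ W.PairwiseDisjoint id} (by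
    intro c hc hchain
    refine ⟨⋃₀ c, ⟨Set.sUnion_subset fun s hs => (hc hs).1, ?_⟩,
      fun s hs => Set.subset_sUnion_of_mem hs⟩
    exact (Set.pairwiseDisjoint_sUnion hchain.directedOn).2 fun s hs => (hc hs).2)
  refine ⟨W, hW.prop.1, hW.prop.2, fun x hx hxW => ?_⟩
  refine hW.le_of_ge (y := insert x W) ⟨Set.insert_subset hx hW.prop.1, ?_⟩
    (Set.subset_insert x W) (Set.mem_insert x W)
  exact hW.prop.2.insert fun w hw _ => hxW w hw

/-- An arbitrary c need not belong to any stage, so it is replaced by a small antichain W from the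
stages, maximal among those disjoint from c. An element e W disjoint from W, taken within a later
stage, then stands in for c: c ≤ a j forces e W ≤ a j. -/
theorem exists_isSparse_of_antichain_card_lt {b : B} {T θ χ : Cardinal.{u}} (hT : T.IsRegular)
    (hθ : θ.IsRegular) (hχθ : χ ≤ θ) (hle : θ ≤ T) (hb : DensityGE b T)
    (hχ : ∀ W : Set B, (∀ w ∈ W, w ≤ b ∧ w ≠ ⊥) → W.PairwiseDisjoint id → #W < χ)
    (hcount : ∀ X : Set B, #X < T → #{W : Set B // W ⊆ X ∧ #W < χ} < T) :
    ∃ S, IsSparse (Set.univ : Set B) S θ := by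
  classical
  -- The value of e is arbitrary when no nonzero element below b is disjoint from W.
  have hex : ∀ W : Set B, ∃ e : B, (∃ c ≤ b, c ≠ ⊥ ∧ ∀ w ∈ W, Disjoint c w) →
      e ≤ b ∧ e ≠ ⊥ ∧ ∀ w ∈ W, Disjoint e w := by
    intro W
    by_cases h : ∃ c ≤ b, c ≠ ⊥ ∧ ∀ w ∈ W, Disjoint c w
    · exact ⟨h.choose, fun _ => h.choose_spec⟩
    · exact ⟨⊥, fun h' => absurd h' h⟩
  choose e he using hex
  obtain ⟨A, a, hAc, hA, ha⟩ := exists_chain hT hle hb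
    (F := fun X => Set.range (fun W : {W : Set B // W ⊆ X ∧ #W < χ} => e W) ∪
      Set.image2 (· \ ·) X X) (by
      intro X hX
      refine (mk_union_le _ _).trans_lt (add_lt_of_lt hT.aleph0_le
        (mk_range_le.trans_lt (hcount X hX)) ?_)
      exact mk_image2_le.trans_lt (mul_lt_of_lt hT.aleph0_le hX hX))
  have hgt : ∀ i : θ.ord.ToType, ∃ j, i < j := fun i => by
    obtain ⟨j, hj⟩ := exists_gt_of_card_lt hθ (s := {i})
      (by rw [mk_singleton]; exact one_lt_aleph0.trans_le hθ.aleph0_le)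
    exact ⟨j, hj i rfl⟩
  have hmono : Monotone A := fun i j hij => by
    rcases hij.eq_or_lt with rfl | h
    · exact le_rfl
    · exact (hA i j h).1
  refine ⟨Set.range a, isSparse_range (mk_ord_toType θ) card_Iio_toType_lt
    (fun i => Set.mem_univ _) (fun i => (ha i).2.1)
    (fun i j hij h => (ha i).2.1 ((ha j).2.2 _ (hA i j hij).2.2 h)) fun c _ hc0 => ?_⟩
  by_cases hcb : c ≤ b
  swap
  · obtain ⟨i₀, -⟩ := exists_gt_of_card_lt hθ (s := ∅) (by simpa using hθ.pos)
    exact ⟨i₀, fun j hj => absurd (hj.trans (ha j).1) hcb⟩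
  obtain ⟨W, hWsub, hWd, hWmax⟩ := exists_maximal_pairwiseDisjoint
    {x : B | x ∈ ⋃ i, A i ∧ x ≤ b ∧ x ≠ ⊥ ∧ Disjoint x c}
  have hWc : #W < χ := hχ W (fun w hw => ⟨(hWsub hw).2.1, (hWsub hw).2.2.1⟩) hWd
  have hWA : ∀ w : W, ∃ i, (w : B) ∈ A i := fun w => Set.mem_iUnion.1 (hWsub w.2).1
  choose r hr using hWA
  obtain ⟨i, hi⟩ := exists_gt_of_card_lt hθ (s := Set.range r)
    (mk_range_le.trans_lt (hWc.trans_le hχθ))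
  -- As #W < χ ≤ θ and θ is regular, W is captured by a single stage.
  have hWi : W ⊆ A i := fun w hw => hmono (hi _ ⟨⟨w, hw⟩, rfl⟩).le (hr ⟨w, hw⟩)
  obtain ⟨heb, he0, heW⟩ := he W ⟨c, hcb, hc0, fun w hw => (hWsub hw).2.2.2.symm⟩
  obtain ⟨k, hk⟩ := hgt i
  refine ⟨k, fun j hj => ?_⟩
  by_contra! hkj
  have heA : e W ∈ A j := hmono hkj ((hA i k hk).2.1 (Or.inl ⟨⟨W, hWi, hWc⟩, rfl⟩))
  obtain ⟨l, hl⟩ := hgt j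
  obtain ⟨m, hm⟩ := hgt l
  have hdA : e W \ a j ∈ A m :=
    (hA l m hm).2.1 (Or.inr ⟨e W, (hA j l hl).1 heA, a j, (hA j l hl).2.2, rfl⟩)
  have hdW : ∀ w ∈ W, Disjoint (e W \ a j) w := fun w hw => (heW w hw).mono_left sdiff_le
  -- This difference lies in a stage and is disjoint from both c and W, so if nonzero it would
  -- belong to W by maximality.
  have hd0 : e W \ a j = ⊥ := by
    by_contra h
    have := hWmax _ ⟨Set.mem_iUnion.2 ⟨m, hdA⟩, sdiff_le.trans heb, h,
      disjoint_sdiff_self_left.mono_right hj⟩ hdW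
    exact h (disjoint_self.1 (hdW _ this))
  exact he0 ((ha j).2.2 _ heA (sdiff_eq_bot_iff.1 hd0))


end

/-! ### Counting small subsets -/

theorem card_subsets_card_lt_succ_le {μ : Cardinal.{u}} (hμ : ℵ₀ ≤ μ) {α : Type u} {X : Set α}
    (hX : #X ≤ 2 ^ μ) : #{W : Set α // W ⊆ X ∧ #W < Order.succ μ} ≤ 2 ^ μ := by
  simp_rw [Order.lt_succ_iff]
  refine (mk_bounded_subset_le X μ).trans ((power_le_power_right
    (max_le hX (hμ.trans (cantor μ).le))).trans ?_)
  rw [← power_mul, mul_eq_self hμ]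

/-- With X indexed injectively by λ, a subset of size below cf(λ) is bounded, so it lies in one of λ
many initial segments of size below λ. The power hypothesis counts the subsets of each segment. -/
theorem card_subsets_card_lt_cof_le {lam : Cardinal.{u}} (hlam : ℵ₀ ≤ lam)
    (h : ∀ μ < lam, μ ^< lam.ord.cof < lam) (hlt : ℵ₀ < lam) {α : Type u} {X : Set α}
    (hX : #X ≤ lam) :
    #{W : Set α // W ⊆ X ∧ #W < lam.ord.cof} ≤ lam := by
  have hX' : #X ≤ #lam.ord.ToType := by rwa [mk_ord_toType]
  obtain ⟨g⟩ := hX'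
  let Y : lam.ord.ToType → Set α := fun x => Subtype.val '' (g ⁻¹' Set.Iio x)
  have hY : ∀ x, #(Y x) < lam := fun x =>
    (mk_image_le.trans (mk_preimage_of_injective _ _ g.injective)).trans_lt (card_Iio_toType_lt x)
  let ν : lam.ord.cof.ord.ToType → Cardinal.{u} := fun i => (Ordinal.ToType.mk.symm i).1.card
  have hν : ∀ i, ν i < lam.ord.cof := fun i => lt_ord.1 (Ordinal.ToType.mk.symm i).2
  let Z : lam.ord.ToType × lam.ord.cof.ord.ToType → Set (Set α) :=
    fun p => {W | W ⊆ Y p.1 ∧ #W ≤ ν p.2}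
  have hZ : ∀ p, #(Z p) ≤ lam := fun p =>
    ((mk_bounded_subset_le (Y p.1) (ν p.2)).trans (le_powerlt _ (hν p.2))).trans
      (h _ (max_lt (hY p.1) hlt)).le
  have hsub : {W : Set α | W ⊆ X ∧ #W < lam.ord.cof} ⊆ ⋃ p, Z p := by
    rintro W ⟨hWX, hW⟩
    have hnc : ¬ IsCofinal (g '' (Subtype.val ⁻¹' W)) := fun hc => by
      have := Order.cof_le hc
      rw [Ordinal.cof_toType] at this
      exact hW.not_ge (this.trans
        (mk_image_le.trans (mk_preimage_of_injective _ _ Subtype.val_injective)))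
    obtain ⟨x, hx⟩ := not_isCofinal_iff.1 hnc
    refine Set.mem_iUnion.2 ⟨(x, Ordinal.ToType.mk ⟨(#W).ord, ord_lt_ord.2 hW⟩), ?_, ?_⟩
    · intro w hw
      exact ⟨⟨w, hWX hw⟩, hx _ ⟨⟨w, hWX hw⟩, hw, rfl⟩, rfl⟩
    · simp [ν]
  refine (mk_le_mk_of_subset hsub).trans ((mk_iUnion_le Z).trans
    ((mul_le_mul' ?_ (ciSup_le' hZ)).trans (mul_eq_self hlam).le))
  rw [mk_prod, lift_id, lift_id, mk_ord_toType, mk_ord_toType]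
  exact (mul_le_mul' le_rfl (Ordinal.cof_ord_le lam)).trans (mul_eq_self hlam).le

theorem card_iUnion_nat_le {α : Type u} {lam : Cardinal.{u}} (hlam : ℵ₀ ≤ lam) {Y : ℕ → Set α}
    (hY : ∀ n, #(Y n) ≤ lam) : #(⋃ n : ULift.{u} ℕ, Y n.down) ≤ lam := by
  have h1 : #(ULift.{u} ℕ) ≤ lam := by simpa using hlam
  have h2 : ⨆ n : ULift.{u} ℕ, #(Y n.down) ≤ lam := ciSup_le' fun n => hY n.down
  exact (mk_iUnion_le fun n : ULift.{u} ℕ => Y n.down).trans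
    ((mul_le_mul' h1 h2).trans (mul_eq_self hlam).le)

/-! ### Assembling subalgebras from sparse sets -/

section

variable {B : Type u} [BooleanAlgebra B]

theorem card_closure_le {X : Set B} {lam : Cardinal.{u}} (hlam : ℵ₀ ≤ lam) (hX : #X ≤ lam) :
    #(BooleanSubalgebra.closure X) ≤ lam := by
  let G : Set B → Set B := fun Y => insert ⊥ (Y ∪ compl '' Y ∪ Set.image2 (· ⊔ ·) Y Y)
  have hG : ∀ Y : Set B, #Y ≤ lam → #(G Y) ≤ lam := fun Y hY =>
    mk_insert_le.trans (add_le_of_le hlam ((mk_union_le _ _).trans (add_le_of_le hlam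
      ((mk_union_le _ _).trans (add_le_of_le hlam hY (mk_image_le.trans hY)))
      (mk_image2_le.trans ((mul_le_mul' hY hY).trans (mul_eq_self hlam).le))))
      (one_lt_aleph0.le.trans hlam))
  have hGn : ∀ n : ℕ, #(G^[n] X) ≤ lam := by
    intro n
    induction n with
    | zero => exact hX
    | succ n ih => rw [Function.iterate_succ_apply']; exact hG _ ih
  have hmono : Monotone fun n : ℕ => G^[n] X := monotone_nat_of_le_succ fun n x hx => by
    rw [Function.iterate_succ_apply']
    exact Or.inr (Or.inl (Or.inl hx))
  have hcompl : ∀ x ∈ ⋃ n : ℕ, G^[n] X, xᶜ ∈ ⋃ n : ℕ, G^[n] X := by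
    intro x hx
    obtain ⟨n, hn⟩ := Set.mem_iUnion.1 hx
    refine Set.mem_iUnion.2 ⟨n + 1, ?_⟩
    rw [Function.iterate_succ_apply']
    exact Or.inr (Or.inl (Or.inr ⟨x, hn, rfl⟩))
  have hsup : ∀ x ∈ ⋃ n : ℕ, G^[n] X, ∀ y ∈ ⋃ n : ℕ, G^[n] X, x ⊔ y ∈ ⋃ n : ℕ, G^[n] X := by
    intro x hx y hy
    obtain ⟨n, hn⟩ := Set.mem_iUnion.1 hx
    obtain ⟨m, hm⟩ := Set.mem_iUnion.1 hy
    refine Set.mem_iUnion.2 ⟨max n m + 1, ?_⟩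
    rw [Function.iterate_succ_apply']
    exact Or.inr (Or.inr ⟨x, hmono (le_max_left n m) hn, y, hmono (le_max_right n m) hm, rfl⟩)
  let D : BooleanSubalgebra B :=
    { carrier := ⋃ n : ℕ, G^[n] X
      supClosed' := fun x hx y hy => hsup x hx y hy
      infClosed' := fun x hx y hy => by
        have := hcompl _ (hsup _ (hcompl x hx) _ (hcompl y hy))
        rwa [compl_sup, compl_compl, compl_compl] at this
      compl_mem' := fun {x} hx => hcompl x hx
      bot_mem' := Set.mem_iUnion.2 ⟨1, Or.inl rfl⟩ }
  have hle : BooleanSubalgebra.closure X ≤ D :=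
    BooleanSubalgebra.closure_le.2 fun x hx => Set.mem_iUnion.2 ⟨0, hx⟩
  have hD : (BooleanSubalgebra.closure X : Set B) ⊆ ⋃ n : ULift.{u} ℕ, G^[n.down] X := by
    intro x hx
    obtain ⟨n, hn⟩ := Set.mem_iUnion.1 (hle hx)
    exact Set.mem_iUnion.2 ⟨⟨n⟩, hn⟩
  exact (mk_le_mk_of_subset hD).trans (card_iUnion_nat_le hlam hGn)

theorem exists_cofinal_family (lam : Cardinal.{u}) : ∃ (ι : Type u) (f : ι → Cardinal.{u}),
    #ι = lam.ord.cof ∧ (∀ i, f i < lam) ∧ ∀ μ < lam, ∃ i, μ ≤ f i := by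
  obtain ⟨s, hs, hsc⟩ := Order.exists_cof_eq lam.ord.ToType
  refine ⟨s, fun i => (Ordinal.ToType.mk.symm i.1).1.card, by rw [hsc, Ordinal.cof_toType],
    fun i => lt_ord.1 (Ordinal.ToType.mk.symm i.1).2, fun μ hμ => ?_⟩
  obtain ⟨i, hi, hle⟩ := hs (Ordinal.ToType.mk ⟨μ.ord, ord_lt_ord.2 hμ⟩)
  refine ⟨⟨i, hi⟩, ?_⟩
  have h := Ordinal.ToType.mk.symm.monotone hle
  rw [OrderIso.symm_apply_apply] at h
  simpa using Ordinal.card_le_card (Subtype.coe_le_coe.2 h)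

theorem exists_subalgebra_of_isSparse {lam : Cardinal.{u}} (hlam : ℵ₀ ≤ lam)
    (h : ∀ μ < lam, ∃ θ ≤ lam, μ < θ ∧ θ.IsRegular ∧ ∃ S, IsSparse (Set.univ : Set B) S θ) :
    ∃ D : BooleanSubalgebra B, algDensity D = lam ∧ #D = lam := by
  obtain ⟨ι, f, hι, hf, hcof⟩ := exists_cofinal_family lam
  choose θ hθ hfθ hreg S hS using fun i => h (f i) (hf i)
  refine ⟨BooleanSubalgebra.closure (⋃ i, S i), algDensity_eq_of_isSparse
    (card_closure_le hlam ?_) fun μ hμ => ?_⟩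
  · refine (mk_iUnion_le S).trans ((mul_le_mul' ?_ (ciSup_le' fun i => ?_)).trans
      (mul_eq_self hlam).le)
    · exact hι.trans_le (Ordinal.cof_ord_le lam)
    · exact (hS i).card_eq.trans_le (hθ i)
  · obtain ⟨i, hi⟩ := hcof μ hμ
    exact ⟨θ i, hi.trans_lt (hfθ i), hreg i, S i, (hS i).mono
      ((Set.subset_iUnion S i).trans BooleanSubalgebra.subset_closure) (Set.subset_univ _)⟩

theorem exists_subalgebra_of_pairwise_disjoint {lam : Cardinal.{u}} (hlam : ℵ₀ ≤ lam)
    {ι : Type u} (hι : #ι ≤ lam) {c : ι → B} (hc : Pairwise fun i j => Disjoint (c i) (c j))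
    {θ : ι → Cardinal.{u}} (hθ : ∀ i, θ i ≤ lam) (hreg : ∀ i, (θ i).IsRegular)
    (hden : ∀ i, DensityGE (c i) (θ i)) (hcof : ∀ μ < lam, ∃ i, μ < θ i) :
    ∃ D : BooleanSubalgebra B, algDensity D = lam ∧ #D = lam := by
  choose A hAc hcA hAle hsup hsdiff S hS using
    fun i => exists_isSparse_of_densityGE (hreg i) (hden i)
  have hbot : ∀ i, ⊥ ∈ A i := fun i => by
    simpa using hsdiff i _ (hcA i) _ (hcA i)
  -- Disjointness of the c i keeps the pieces from interacting: the generated subalgebra has no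
  -- elements below c i other than those of A i, so S i stays sparse.
  have hinf : ∀ i, ∀ x ∈ BooleanSubalgebra.closure (⋃ i, A i), x ⊓ c i ∈ A i := by
    intro i x hx
    induction hx using BooleanSubalgebra.closure_bot_sup_induction with
    | mem x hx =>
      obtain ⟨j, hj⟩ := Set.mem_iUnion.1 hx
      rcases eq_or_ne j i with rfl | hji
      · rwa [inf_eq_left.2 (hAle j x hj)]
      · rw [((hc hji).mono_left (hAle j x hj)).eq_bot]
        exact hbot i
    | bot => rw [bot_inf_eq]; exact hbot i
    | sup x hx y hy ihx ihy => rw [inf_sup_right]; exact hsup i _ ihx _ ihy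
    | compl x hx ih =>
      have := hsdiff i _ (hcA i) _ ih
      rwa [sdiff_inf_self_right, sdiff_eq, inf_comm] at this
  refine ⟨BooleanSubalgebra.closure (⋃ i, A i), algDensity_eq_of_isSparse
    (card_closure_le hlam ?_) fun μ hμ => ?_⟩
  · exact (mk_iUnion_le A).trans ((mul_le_mul' hι (ciSup_le' fun i =>
      (hAc i).trans (hθ i))).trans (mul_eq_self hlam).le)
  · obtain ⟨i, hi⟩ := hcof μ hμ
    refine ⟨θ i, hi, hreg i, S i, ((hS i).subset.trans (Set.subset_iUnion A i)).trans
      BooleanSubalgebra.subset_closure, (hS i).ne_bot, (hS i).card_eq, fun x hx hx0 => ?_⟩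
    by_cases hxc : x ≤ c i
    · have := hinf i x hx
      rw [inf_eq_left.2 hxc] at this
      exact (hS i).card_lt x this hx0
    · have : {s ∈ S i | x ≤ s} = ∅ :=
        Set.eq_empty_of_forall_notMem fun s hs => hxc (hs.2.trans (hAle i s ((hS i).subset hs.1)))
      rw [this, mk_eq_zero]
      exact (hreg i).pos

theorem exists_subalgebra_of_isRegular {lam : Cardinal.{u}} (hlam : lam.IsRegular)
    (h : lam ≤ algDensity B) : ∃ D : BooleanSubalgebra B, algDensity D = lam ∧ #D = lam :=
  exists_subalgebra_of_pairwise_disjoint hlam.aleph0_le (ι := PUnit.{u + 1}) (c := fun _ => ⊤)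
    (θ := fun _ => lam) (by simpa using one_lt_aleph0.le.trans hlam.aleph0_le)
    (fun i j hij => absurd (Subsingleton.elim i j) hij) (fun _ => le_rfl) (fun _ => hlam)
    (fun _ => densityGE_top h) fun μ hμ => ⟨PUnit.unit, hμ⟩

/-! ### Antichains and dense sets -/

theorem exists_isSparse_of_pairwiseDisjoint {W : Set B} (h0 : ∀ w ∈ W, w ≠ ⊥)
    (hW : W.PairwiseDisjoint id) {θ : Cardinal.{u}} (hθ : ℵ₀ ≤ θ) (hle : θ ≤ #W) :
    ∃ S, IsSparse (Set.univ : Set B) S θ := by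
  obtain ⟨S, hSW, hS⟩ := le_mk_iff_exists_subset.1 hle
  refine ⟨S, Set.subset_univ _, fun s hs => h0 s (hSW hs), hS, fun x _ hx0 => ?_⟩
  refine (mk_le_one_iff_set_subsingleton.2 fun s hs t ht => ?_).trans_lt
    (one_lt_aleph0.trans_le hθ)
  by_contra hst
  exact hx0 (le_bot_iff.1 (hW (hSW hs.1) (hSW ht.1) hst hs.2 ht.2))

/-- A maximal antichain of members of X below y determines y: if y and z shared it, a member of X
below y \ z would contradict maximality. -/
theorem card_le_of_isAlgDense {X : Set B} (hX : IsAlgDense X) {χ : Cardinal.{u}}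
    (hχ : ∀ W : Set B, (∀ w ∈ W, w ≠ ⊥) → W.PairwiseDisjoint id → #W < χ) :
    #B ≤ #{W : Set B // W ⊆ X ∧ #W < χ} := by
  choose W hWsub hWd hWmax using
    fun y : B => exists_maximal_pairwiseDisjoint {x ∈ X | x ≤ y}
  refine mk_le_of_injective (f := fun y => ⟨W y, (hWsub y).trans (Set.sep_subset _ _),
    hχ (W y) (fun w hw => hX.1 w (hWsub y hw).1) (hWd y)⟩) ?_
  have key : ∀ y z, W y = W z → y ≤ z := by
    intro y z hyz
    rw [← sdiff_eq_bot_iff]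
    by_contra hne
    obtain ⟨x, hx, hxyz⟩ := hX.2 _ hne
    have hd : ∀ w ∈ W y, Disjoint x w := fun w hw => by
      rw [hyz] at hw
      exact disjoint_sdiff_self_left.mono hxyz (hWsub z hw).2
    exact hX.1 x hx (disjoint_self.1 (hd x (hWmax y x ⟨hx, hxyz.trans sdiff_le⟩ hd)))
  intro y z hyz
  have h := congrArg Subtype.val hyz
  exact le_antisymm (key y z h) (key z y h.symm)

/-- Otherwise the elements with at most λ many elements dense below them are themselves dense.
Uniting these small sets over a maximal antichain of such elements would give a dense set of size at
most λ. -/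
theorem exists_forall_densityGE {lam : Cardinal.{u}} (hlam : ℵ₀ ≤ lam) (h : lam < algDensity B)
    (hanti : ∀ W : Set B, (∀ w ∈ W, w ≠ ⊥) → W.PairwiseDisjoint id → #W ≤ lam) :
    ∃ b : B, b ≠ ⊥ ∧ ∀ c ≤ b, c ≠ ⊥ → DensityGE c (Order.succ lam) := by
  by_contra! hno
  obtain ⟨W, hWsub, hWd, hWmax⟩ := exists_maximal_pairwiseDisjoint
    {c : B | c ≠ ⊥ ∧ ¬ DensityGE c (Order.succ lam)}
  have hthin : ∀ w : W, ∃ X : Set B, #X ≤ lam ∧ ∀ a ≤ (w : B), a ≠ ⊥ → ∃ x ∈ X, x ≤ a ∧ x ≠ ⊥ :=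
    fun w => by
      have := (hWsub w.2).2
      simp only [DensityGE, not_forall, not_exists, not_and] at this
      push Not at this
      obtain ⟨X, hX, hX'⟩ := this
      exact ⟨X, Order.lt_succ_iff.1 hX, fun a ha ha0 => by
        simpa [and_left_comm] using hX' a ha ha0⟩
  choose X hXc hX using hthin
  have hdense : IsAlgDense {x ∈ ⋃ w, X w | x ≠ ⊥} := by
    refine ⟨fun x hx => hx.2, fun y hy => ?_⟩
    obtain ⟨c, hcy, hc0, hc⟩ := hno y hy
    have : ∃ w ∈ W, ¬ Disjoint c w := by
      by_contra! hd
      exact hc0 (disjoint_self.1 (hd c (hWmax c ⟨hc0, hc⟩ hd)))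
    obtain ⟨w, hw, hcw⟩ := this
    obtain ⟨x, hx, hxle, hx0⟩ := hX ⟨w, hw⟩ (c ⊓ w) inf_le_right fun h => hcw (disjoint_iff.2 h)
    exact ⟨x, ⟨Set.mem_iUnion.2 ⟨_, hx⟩, hx0⟩, hxle.trans (inf_le_left.trans hcy)⟩
  refine h.not_ge ((algDensity_le_of_isAlgDense hdense).trans
    ((mk_le_mk_of_subset (Set.sep_subset _ _)).trans ((mk_iUnion_le X).trans
      ((mul_le_mul' ?_ (ciSup_le' hXc)).trans (mul_eq_self hlam).le))))
  exact hanti W (fun w hw => (hWsub hw).1) hWd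

theorem exists_isSparse_succ {μ : Cardinal.{u}} (hμ : ℵ₀ ≤ μ)
    (h : 2 ^ μ < algDensity B ∨ 2 ^ μ < #B) :
    ∃ S, IsSparse (Set.univ : Set B) S (Order.succ μ) := by
  by_cases hanti : ∃ W : Set B, (∀ w ∈ W, w ≠ ⊥) ∧ W.PairwiseDisjoint id ∧ Order.succ μ ≤ #W
  · obtain ⟨W, h0, hW, hle⟩ := hanti
    exact exists_isSparse_of_pairwiseDisjoint h0 hW (hμ.trans (Order.le_succ μ)) hle
  push Not at hanti
  -- If 2 ^ μ < #B, a dense set of size at most 2 ^ μ would code B by its subsets of size at most μ,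
  -- of which there are at most 2 ^ μ.
  have hπ : 2 ^ μ < algDensity B := by
    refine h.elim id fun h => ?_
    by_contra! hle
    obtain ⟨X, hX, hXc⟩ := exists_isAlgDense_card_eq B
    exact h.not_ge ((card_le_of_isAlgDense hX hanti).trans
      (card_subsets_card_lt_succ_le hμ (hXc.trans_le hle)))
  -- The chain has length μ⁺ but stages of size up to 2 ^ μ, leaving room to treat every subset of
  -- size at most μ.
  exact exists_isSparse_of_antichain_card_lt (b := ⊤) (T := Order.succ (2 ^ μ))
    (isRegular_succ (hμ.trans (cantor μ).le)) (isRegular_succ hμ) le_rfl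
    (Order.succ_le_succ (cantor μ).le) (densityGE_top (Order.succ_le_of_lt hπ))
    (fun W hW => hanti W fun w hw => (hW w hw).2)
    fun X hX => Order.lt_succ_iff.2 (card_subsets_card_lt_succ_le hμ (Order.lt_succ_iff.1 hX))

/-! ### Singular λ and the main theorem -/

theorem exists_subalgebra_of_two_power_lt {lam : Cardinal.{u}} (hlam : lam.IsSingular)
    (h : ∀ μ < lam, 2 ^ μ < algDensity B ∨ 2 ^ μ < #B) :
    ∃ D : BooleanSubalgebra B, algDensity D = lam ∧ #D = lam := by
  refine exists_subalgebra_of_isSparse hlam.aleph0_le fun μ hμ => ?_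
  have hlt : max ℵ₀ μ < lam := max_lt (hlam.aleph0_le.lt_of_ne fun h =>
    not_isSingular_aleph0 (h ▸ hlam)) hμ
  exact ⟨Order.succ (max ℵ₀ μ), Order.succ_le_of_lt hlt,
    Order.lt_succ_iff.2 (le_max_right _ _), isRegular_succ (le_max_left _ _),
    exists_isSparse_succ (le_max_left _ _) (h _ hlt)⟩

theorem exists_subalgebra_of_powerlt_cof_lt {lam : Cardinal.{u}} (hlam : lam.IsSingular)
    (h : lam < algDensity B) (hpow : ∀ μ < lam, μ ^< lam.ord.cof < lam) :
    ∃ D : BooleanSubalgebra B, algDensity D = lam ∧ #D = lam := by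
  have hω : ℵ₀ < lam := hlam.aleph0_le.lt_of_ne fun h => not_isSingular_aleph0 (h ▸ hlam)
  by_cases hanti : ∃ W : Set B, (∀ w ∈ W, w ≠ ⊥) ∧ W.PairwiseDisjoint id ∧ lam < #W
  · obtain ⟨W, h0, hW, hlt⟩ := hanti
    refine exists_subalgebra_of_isSparse hlam.aleph0_le fun μ hμ => ?_
    have hlt' : max ℵ₀ μ < lam := max_lt hω hμ
    exact ⟨Order.succ (max ℵ₀ μ), Order.succ_le_of_lt hlt',
      Order.lt_succ_iff.2 (le_max_right _ _), isRegular_succ (le_max_left _ _),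
      exists_isSparse_of_pairwiseDisjoint h0 hW ((le_max_left _ _).trans (Order.le_succ _))
        ((Order.succ_le_of_lt hlt').trans hlt.le)⟩
  push Not at hanti
  obtain ⟨b, hb0, hb⟩ := exists_forall_densityGE hlam.aleph0_le h hanti
  by_cases hbig : ∃ W : Set B, (∀ w ∈ W, w ≤ b ∧ w ≠ ⊥) ∧ W.PairwiseDisjoint id ∧
      lam.ord.cof ≤ #W
  · obtain ⟨W, hW0, hWd, hle⟩ := hbig
    obtain ⟨ι, f, hι, hf, hcof⟩ := exists_cofinal_family lam
    rw [← hι] at hle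
    obtain ⟨g⟩ := hle
    have hθ : ∀ i, Order.succ (max ℵ₀ (f i)) ≤ lam := fun i =>
      Order.succ_le_of_lt (max_lt hω (hf i))
    refine exists_subalgebra_of_pairwise_disjoint hlam.aleph0_le (c := fun i => (g i : B))
      (θ := fun i => Order.succ (max ℵ₀ (f i))) (hι.trans_le (Ordinal.cof_ord_le lam))
      (fun i j hij => hWd (g i).2 (g j).2 fun h => hij (g.injective (Subtype.ext h)))
      hθ (fun i => isRegular_succ (le_max_left _ _)) (fun i => ?_) fun μ hμ => ?_
    · exact (hb _ (hW0 _ (g i).2).1 (hW0 _ (g i).2).2).mono ((hθ i).trans (Order.le_succ _))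
    · obtain ⟨i, hi⟩ := hcof μ hμ
      exact ⟨i, Order.lt_succ_iff.2 (hi.trans (le_max_right _ _))⟩
  push Not at hbig
  refine exists_subalgebra_of_isSparse hlam.aleph0_le fun μ hμ => ?_
  -- Including cf(λ) makes the chain long enough that antichains, being smaller than cf(λ), are
  -- captured by one stage; singularity keeps the maximum below λ.
  have hlt : max (max ℵ₀ lam.ord.cof) μ < lam := max_lt (max_lt hω hlam.cof_ord_lt) hμ
  have hle : ℵ₀ ≤ max (max ℵ₀ lam.ord.cof) μ := (le_max_left _ _).trans (le_max_left _ _)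
  refine ⟨Order.succ (max (max ℵ₀ lam.ord.cof) μ), Order.succ_le_of_lt hlt,
    Order.lt_succ_iff.2 (le_max_right _ _), isRegular_succ hle, ?_⟩
  exact exists_isSparse_of_antichain_card_lt (isRegular_succ hlam.aleph0_le) (isRegular_succ hle)
    (((le_max_right _ _).trans (le_max_left _ _)).trans (Order.le_succ _))
    (Order.succ_le_succ hlt.le) (hb b le_rfl hb0) hbig
    fun X hX => Order.lt_succ_iff.2
      (card_subsets_card_lt_cof_le hlam.aleph0_le hpow hω (Order.lt_succ_iff.1 hX))

end

theorem mainTheorem2 (B : Type u) [BooleanAlgebra B] (lam : Cardinal.{u}) (hlam : ℵ₀ ≤ lam)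
    (h : (lam < algDensity B ∧
            (lam.ord.cof = ℵ₀ ∨
              (∀ μ : Cardinal.{u}, μ < lam → μ ^< lam.ord.cof < lam) ∨
              (∀ μ : Cardinal.{u}, μ < lam → 2 ^ μ < algDensity B))) ∨
          (lam ≤ algDensity B ∧ ∀ μ : Cardinal.{u}, μ < lam → 2 ^ μ < #B)) :
    ∃ B' : BooleanSubalgebra B, algDensity B' = lam ∧ #B' = lam := by
  rcases isRegular_or_isSingular hlam with hreg | hsing
  · exact exists_subalgebra_of_isRegular hreg (h.elim (fun h => h.1.le) fun h => h.1)
  rcases h with ⟨hπ, hA | hB | hC⟩ | ⟨-, hC⟩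
  · refine exists_subalgebra_of_powerlt_cof_lt hsing hπ fun μ hμ => ?_
    -- For countable cofinality only finite exponents occur, and these do not raise infinite
    -- cardinals.
    rw [hA]
    exact (powerlt_aleph0_le μ).trans_lt (max_lt hμ (hlam.lt_of_ne fun h =>
      not_isSingular_aleph0 (h ▸ hsing)))
  · exact exists_subalgebra_of_powerlt_cof_lt hsing hπ hB
  · exact exists_subalgebra_of_two_power_lt hsing fun μ hμ => Or.inl (hC μ hμ)
  · exact exists_subalgebra_of_two_power_lt hsing fun μ hμ => Or.inr (hC μ hμ)
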